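/- Let $N\ge 2$ and let $B_N$ be the braid group on $N$ strands, in Artin's presentation. Every braid $x\in B_N$ has a unique left normal form $x=\Delta^i p_1\cdots p_r$, where $\Delta$ is the half twist, $i\in\mathbb Z$, $r\ge 0$, and $p_1,\dots,p_r\in S_N\setminus\{1\}$, identified with their permutation braids, form a left weighted sequence such that $p_1$ is not the involution $k\mapsto N-k+1$. (Left weighted means that every Artin generator with which the permutation braid $p_{t+1}$ can start is one with which the permutation braid $p_t$ can end.) Write $\inf(x)=i$ for the infimum and $\ell(x)=r$ for the canonical length of $x$, and for integers $i,s$ let $$[i,s]=\{x\in B_N : i\le \inf(x)\le \inf(x)+\ell(x)\le s\}.$$ Let $k,\ell,m\ge 0$ be integers and let $a_1,\dots,a_k,b_1,\dots,b_k\in B_N$ be braids with infimum in $\{0,1\}$ and canonical length at most $\ell$. Let $a$ be a product of at most $m$ elements of $\{a_1,\dots,a_k\}^{\pm1}$, and let $b$ be a product of at most $m$ elements of $\{b_1,\dots,b_k\}^{\pm1}$. Then $$a^{-1}b^{-1}ab\in[-4m(\ell+1),\,4m(\ell+1)].$$ -/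

import Mathlib

namespace Braid

/-- Artin's relators for the braid group on `N` strands: `σ i` and `σ j` commute when
`j ≥ i + 2`, and `σ i * σ j * σ i = σ j * σ i * σ j` when `j = i + 1`. -/
def relators (N : ℕ) : Set (FreeGroup (Fin (N - 1))) :=
  {r | (∃ i j : Fin (N - 1), i.val + 2 ≤ j.val ∧
          r = (FreeGroup.of i * FreeGroup.of j) * (FreeGroup.of j * FreeGroup.of i)⁻¹) ∨
       (∃ i j : Fin (N - 1), i.val + 1 = j.val ∧
          r = (FreeGroup.of i * FreeGroup.of j * FreeGroup.of i) *
              (FreeGroup.of j * FreeGroup.of i * FreeGroup.of j)⁻¹)}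

/-- The braid group `B_N`, in Artin's presentation. -/
abbrev BraidGroup (N : ℕ) : Type := PresentedGroup (relators N)

/-- The Artin generator `σ i`, crossing the strands in positions `i` and `i + 1`. -/
def σ {N : ℕ} (i : Fin (N - 1)) : BraidGroup N := PresentedGroup.of i

/-- The position `i`, as one of the `N` symbols. -/
def lo {N : ℕ} (i : Fin (N - 1)) : Fin N := ⟨i.val, by have := i.isLt; omega⟩

/-- The position `i + 1`, as one of the `N` symbols. -/
def hi {N : ℕ} (i : Fin (N - 1)) : Fin N := ⟨i.val + 1, by have := i.isLt; omega⟩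

/-- The adjacent transposition of `i` and `i + 1` in `S_N`. -/
def adjSwap {N : ℕ} (i : Fin (N - 1)) : Equiv.Perm (Fin N) := Equiv.swap (lo i) (hi i)

/-- `w` is a reduced word for the permutation `p`: a word in the adjacent transpositions with
product `p`, of the least possible length. -/
def IsReducedWord {N : ℕ} (p : Equiv.Perm (Fin N)) (w : List (Fin (N - 1))) : Prop :=
  (w.map adjSwap).prod = p ∧
    ∀ w' : List (Fin (N - 1)), (w'.map adjSwap).prod = p → w.length ≤ w'.length

theorem exists_word {N : ℕ} (p : Equiv.Perm (Fin N)) :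
    ∃ w : List (Fin (N - 1)), (w.map adjSwap).prod = p := by
  rcases N with _ | n
  · exact ⟨[], Subsingleton.elim _ _⟩
  · have hp : p ∈ Submonoid.closure
        (Set.range fun i : Fin n => Equiv.swap i.castSucc i.succ) := by
      rw [Equiv.Perm.mclosure_swap_castSucc_succ]; trivial
    induction hp using Submonoid.closure_induction with
    | mem x hx =>
      obtain ⟨i, rfl⟩ := hx
      refine ⟨[i], ?_⟩
      simp only [List.map_cons, List.map_nil, List.prod_cons, List.prod_nil, mul_one]
      rfl
    | one => exact ⟨[], rfl⟩
    | mul x y _ _ hx hy =>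
      obtain ⟨u, rfl⟩ := hx
      obtain ⟨v, rfl⟩ := hy
      exact ⟨u ++ v, by simp⟩

theorem exists_isReducedWord {N : ℕ} (p : Equiv.Perm (Fin N)) :
    ∃ w : List (Fin (N - 1)), IsReducedWord p w := by
  classical
  have h : ∃ n, ∃ w : List (Fin (N - 1)), (w.map adjSwap).prod = p ∧ w.length = n :=
    let ⟨w, hw⟩ := exists_word p
    ⟨w.length, w, hw, rfl⟩
  obtain ⟨w, hw, hl⟩ := Nat.find_spec h
  exact ⟨w, hw, fun w' hw' => hl ▸ Nat.find_min' h ⟨w', hw', rfl⟩⟩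

/-- The permutation braid of `p`: the positive braid `σ i₁ * ⋯ * σ iᵣ` of a reduced word
`i₁, …, iᵣ` for `p`. (All reduced words of `p` give the same braid, by Matsumoto's theorem, so
it does not matter which of them is chosen.) -/
noncomputable def permBraid {N : ℕ} (p : Equiv.Perm (Fin N)) : BraidGroup N :=
  ((exists_isReducedWord p).choose.map σ).prod

/-- The fundamental (half twist) braid `Δ`: the permutation braid of the order-reversing
permutation, `k ↦ N - k + 1` on the symbols `1, …, N`. -/
noncomputable def Δ (N : ℕ) : BraidGroup N := permBraid (Fin.revPerm : Equiv.Perm (Fin N))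

/-- The pair `(p, q)` is left weighted: every generator `σ i` with which the permutation braid of
`q` can start (`q⁻¹ i > q⁻¹ (i + 1)`) is one with which that of `p` can end
(`p i > p (i + 1)`). -/
def LeftWeighted {N : ℕ} (p q : Equiv.Perm (Fin N)) : Prop :=
  ∀ i : Fin (N - 1), q⁻¹ (hi i) < q⁻¹ (lo i) → p (hi i) < p (lo i)

/-- `x` is the braid `(i, (p₁, …, pₗ))`, that is, `Δ ^ i * p₁ * ⋯ * pₗ` is the left normal form
of `x`: the sequence of permutations is left weighted, without trivial factors, and `p₁` is not
the order-reversing permutation. Every braid on `N ≥ 2` strands has exactly one left normal form;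
`i` is its infimum, and `ℓ`, the length of the sequence, is its canonical length. -/
structure IsLeftNormalForm {N : ℕ} (x : BraidGroup N) (i : ℤ) (p : List (Equiv.Perm (Fin N))) :
    Prop where
  eq_prod : x = Δ N ^ i * (p.map permBraid).prod
  leftWeighted : p.IsChain LeftWeighted
  ne_one : ∀ q ∈ p, q ≠ 1
  head_ne : p.head? ≠ some Fin.revPerm

/-- The set `[i, s]` of the braids `x` with `i ≤ inf x ≤ inf x + ℓ(x) ≤ s`, where `inf x` and
`ℓ(x)` are the infimum and the canonical length, read off from the left normal form of `x`. -/
def interval (N : ℕ) (i s : ℤ) : Set (BraidGroup N) :=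
  {x | ∃ (j : ℤ) (p : List (Equiv.Perm (Fin N))), IsLeftNormalForm x j p ∧
    i ≤ j ∧ j ≤ j + (p.length : ℤ) ∧ j + (p.length : ℤ) ≤ s}

/-- `x` is a product of at most `m` elements of `{g₁, …, gₖ}^{±1}`. -/
def IsShortProduct {G : Type*} [Group G] {k : ℕ} (m : ℕ) (g : Fin k → G) (x : G) : Prop :=
  ∃ w : List G, w.length ≤ m ∧ (∀ y ∈ w, ∃ j, y = g j ∨ y = (g j)⁻¹) ∧ x = w.prod

end Braid

namespace Braid

variable {N : ℕ}

/-! Call a braid a member of the box `[i, s]` if it is `Δ ^ i` times exactly `s - i` permutation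
braids, with no normal form condition. Every permutation braid divides `Δ` with a permutation braid
as quotient (`permBraid_mul_complement`), so conjugation by `Δ` permutes the permutation braids.
Hence boxes multiply by adding endpoints (`mul_mem_box`) and invert by negating and exchanging them
(`inv_mem_box`). Each generator lies in `[-(l+1), l+1]`, so the commutator lies in the required box.

It remains to normalize (`box_subset_interval`): sliding crossings to the left makes the factors
left weighted, then trivial factors drop off the end and half twists join the power of `Δ`. Both
moves only shrink the interval. Sliding requires that permutation braids not depend on the chosen
reduced word, which is Matsumoto's theorem. -/

/-! ### Adjacent transpositions and inversions -/

theorem lo_lt_hi (i : Fin (N - 1)) : lo i < hi i := by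
  simp [lo, hi, Fin.lt_def]

theorem adjSwap_mul_self (i : Fin (N - 1)) : adjSwap i * adjSwap i = 1 :=
  Equiv.swap_mul_self _ _

theorem adjSwap_mul_cancel (i : Fin (N - 1)) (p : Equiv.Perm (Fin N)) :
    adjSwap i * (adjSwap i * p) = p := by
  rw [← mul_assoc, adjSwap_mul_self, one_mul]

theorem adjSwap_inv (i : Fin (N - 1)) : (adjSwap i)⁻¹ = adjSwap i := Equiv.swap_inv _ _

theorem adjSwap_lo (i : Fin (N - 1)) : adjSwap i (lo i) = hi i := Equiv.swap_apply_left _ _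

theorem adjSwap_hi (i : Fin (N - 1)) : adjSwap i (hi i) = lo i := Equiv.swap_apply_right _ _

theorem adjSwap_mul_inv_apply (i : Fin (N - 1)) (p : Equiv.Perm (Fin N)) (a : Fin N) :
    (adjSwap i * p)⁻¹ a = p⁻¹ (adjSwap i a) := by
  rw [mul_inv_rev, adjSwap_inv, Equiv.Perm.mul_apply]

theorem adjSwap_of_ne {i : Fin (N - 1)} {a : Fin N} (h : a ≠ lo i) (h' : a ≠ hi i) :
    adjSwap i a = a := Equiv.swap_apply_of_ne_of_ne h h'

theorem adjSwap_val (i : Fin (N - 1)) (a : Fin N) : (adjSwap i a).val =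
    if a.val = i.val then i.val + 1 else if a.val = i.val + 1 then i.val else a.val := by
  simp only [adjSwap, Equiv.swap_apply_def, lo, hi, Fin.ext_iff]
  split_ifs <;> rfl

theorem adjSwap_lt {i : Fin (N - 1)} {a b : Fin N} (h : a < b) (hne : ¬(a = lo i ∧ b = hi i)) :
    adjSwap i a < adjSwap i b := by
  have h' : a.val < b.val := h
  simp only [lo, hi, Fin.ext_iff] at hne
  rw [Fin.lt_def, adjSwap_val, adjSwap_val]
  split_ifs <;> omega

/-- The pairs of symbols that `p` puts in the wrong order. -/
def inversions (p : Equiv.Perm (Fin N)) : Finset (Fin N × Fin N) :=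
  Finset.univ.filter fun x => x.1 < x.2 ∧ p⁻¹ x.2 < p⁻¹ x.1

/-- The number of inversions of a permutation. -/
def len (p : Equiv.Perm (Fin N)) : ℕ := (inversions p).card

theorem mem_inversions {p : Equiv.Perm (Fin N)} {x : Fin N × Fin N} :
    x ∈ inversions p ↔ x.1 < x.2 ∧ p⁻¹ x.2 < p⁻¹ x.1 := by
  simp [inversions]

theorem len_one : len (1 : Equiv.Perm (Fin N)) = 0 := by
  simp only [len, Finset.card_eq_zero, Finset.eq_empty_iff_forall_notMem, mem_inversions]
  rintro x ⟨h, h'⟩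
  exact lt_asymm h h'

theorem len_inv (p : Equiv.Perm (Fin N)) : len p⁻¹ = len p := by
  refine Finset.card_bij (fun x _ => (p x.2, p x.1)) ?_ ?_ ?_
  · intro x hx
    rw [mem_inversions] at hx ⊢
    simpa using hx.symm
  · rintro ⟨a, b⟩ _ ⟨c, d⟩ _ h
    simp only [Prod.mk.injEq, EmbeddingLike.apply_eq_iff_eq] at h
    rw [h.1, h.2]
  · rintro ⟨a, b⟩ hx
    rw [mem_inversions] at hx
    refine ⟨(p⁻¹ b, p⁻¹ a), ?_, by simp⟩
    rw [mem_inversions]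
    simpa using hx.symm

/-- The transposition keeps the order of every pair except `(lo i, hi i)`, so applying it to both
entries carries the old inversions onto the new ones other than that pair. -/
theorem len_adjSwap_mul {i : Fin (N - 1)} {p : Equiv.Perm (Fin N)}
    (h : p⁻¹ (lo i) < p⁻¹ (hi i)) : len (adjSwap i * p) = len p + 1 := by
  have key : inversions (adjSwap i * p) = insert (lo i, hi i)
      ((inversions p).map ((adjSwap i).prodCongr (adjSwap i)).toEmbedding) := by
    ext ⟨a, b⟩
    rw [Finset.mem_insert, Finset.mem_map_equiv, mem_inversions, mem_inversions,
      adjSwap_mul_inv_apply, adjSwap_mul_inv_apply]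
    have e : ((adjSwap i).prodCongr (adjSwap i)).symm (a, b) = (adjSwap i a, adjSwap i b) := by
      simp [adjSwap]
    rw [e, Prod.mk.injEq]
    by_cases hab : a = lo i ∧ b = hi i
    · obtain ⟨rfl, rfl⟩ := hab
      simp only [adjSwap_lo, adjSwap_hi, h, lo_lt_hi, true_or, and_self]
    · simp only [hab, false_or]
      refine and_congr_left fun h2 => ⟨fun h1 => adjSwap_lt h1 hab, fun h1 => ?_⟩
      have h3 := adjSwap_lt (i := i) h1 (by
        rintro ⟨h4, h5⟩
        rw [h4, h5] at h2
        exact lt_asymm h h2)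
      simpa [adjSwap] using h3
  rw [len, key, Finset.card_insert_of_notMem, Finset.card_map, len]
  rw [Finset.mem_map_equiv, mem_inversions]
  simp only [Equiv.prodCongr_symm, Equiv.prodCongr_apply, Prod.map_apply]
  rintro ⟨h1, -⟩
  have e : (adjSwap i).symm = adjSwap i := adjSwap_inv i
  rw [e, adjSwap_lo, adjSwap_hi] at h1
  exact lt_asymm h1 (lo_lt_hi i)

theorem len_adjSwap_mul_of_descent {i : Fin (N - 1)} {p : Equiv.Perm (Fin N)}
    (h : p⁻¹ (hi i) < p⁻¹ (lo i)) : len (adjSwap i * p) + 1 = len p := by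
  rw [← len_adjSwap_mul (i := i) (p := adjSwap i * p), adjSwap_mul_cancel]
  rwa [adjSwap_mul_inv_apply, adjSwap_mul_inv_apply, adjSwap_lo, adjSwap_hi]

theorem len_mul_adjSwap {i : Fin (N - 1)} {p : Equiv.Perm (Fin N)}
    (h : p (lo i) < p (hi i)) : len (p * adjSwap i) = len p + 1 := by
  rw [← len_inv, mul_inv_rev, adjSwap_inv, len_adjSwap_mul (by simpa using h), len_inv]

theorem inv_lt_or_gt (p : Equiv.Perm (Fin N)) (i : Fin (N - 1)) :
    p (lo i) < p (hi i) ∨ p (hi i) < p (lo i) :=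
  lt_or_gt_of_ne (p.injective.ne (lo_lt_hi i).ne)

theorem eq_one_of_forall_lt {p : Equiv.Perm (Fin N)} (h : ∀ i, p (lo i) < p (hi i)) : p = 1 := by
  rcases N with _ | n
  · exact Subsingleton.elim _ _
  · have hm : StrictMono p := Fin.strictMono_iff_lt_succ.2 fun i => h i
    have : p = (hm.orderIsoOfSurjective p p.surjective).toEquiv := Equiv.ext fun _ => rfl
    rw [this, Subsingleton.elim (hm.orderIsoOfSurjective p p.surjective) (OrderIso.refl _)]
    rfl

theorem eq_revPerm_of_forall_lt {p : Equiv.Perm (Fin N)} (h : ∀ i, p (hi i) < p (lo i)) :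
    p = Fin.revPerm := by
  have : Fin.revPerm * p = 1 := eq_one_of_forall_lt fun i => by simpa using h i
  rw [eq_inv_of_mul_eq_one_right this]
  rfl

/-! ### Reduced words and Matsumoto's theorem -/

/-- The permutation spelled by a word in the adjacent transpositions. -/
def wordPerm (w : List (Fin (N - 1))) : Equiv.Perm (Fin N) := (w.map adjSwap).prod

/-- The positive braid spelled by a word in the Artin generators. -/
def wordBraid (w : List (Fin (N - 1))) : BraidGroup N := (w.map σ).prod

theorem wordPerm_cons (i : Fin (N - 1)) (w : List (Fin (N - 1))) :
    wordPerm (i :: w) = adjSwap i * wordPerm w := by simp [wordPerm]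

theorem wordBraid_cons (i : Fin (N - 1)) (w : List (Fin (N - 1))) :
    wordBraid (i :: w) = σ i * wordBraid w := by simp [wordBraid]

theorem len_wordPerm_le (w : List (Fin (N - 1))) : len (wordPerm w) ≤ w.length := by
  induction w with
  | nil => simp [wordPerm, len_one]
  | cons i w ih =>
    rw [wordPerm_cons, List.length_cons]
    rcases inv_lt_or_gt (wordPerm w)⁻¹ i with h | h
    · rw [len_adjSwap_mul h]; omega
    · have := len_adjSwap_mul_of_descent h; omega

/-- Peeling off a descent of `p⁻¹` lowers `len` by one. With `len_wordPerm_le` this identifies `len`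
with the reduced length. -/
theorem exists_wordPerm_eq (n : ℕ) (p : Equiv.Perm (Fin N)) (hp : len p = n) :
    ∃ w : List (Fin (N - 1)), wordPerm w = p ∧ w.length = n := by
  induction n generalizing p with
  | zero =>
    refine ⟨[], ?_, rfl⟩
    have : p⁻¹ = 1 := eq_one_of_forall_lt fun i => by
      refine (inv_lt_or_gt p⁻¹ i).resolve_right fun h => ?_
      have := len_adjSwap_mul_of_descent h
      omega
    rw [inv_eq_one.1 this]; rfl
  | succ n ih =>
    have : ∃ i, p⁻¹ (hi i) < p⁻¹ (lo i) := by
      by_contra! hc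
      have h1 : p⁻¹ = 1 := eq_one_of_forall_lt fun i =>
        (inv_lt_or_gt p⁻¹ i).resolve_right (hc i).not_gt
      rw [inv_eq_one.1 h1, len_one] at hp
      omega
    obtain ⟨i, hi⟩ := this
    obtain ⟨w, hw, hl⟩ := ih (adjSwap i * p) (by have := len_adjSwap_mul_of_descent hi; omega)
    exact ⟨i :: w, by rw [wordPerm_cons, hw, adjSwap_mul_cancel], by simp [hl]⟩

theorem σ_comm {i j : Fin (N - 1)} (h : i.val + 2 ≤ j.val) :
    (σ i * σ j : BraidGroup N) = σ j * σ i := by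
  have : PresentedGroup.mk (relators N) _ = 1 :=
    PresentedGroup.one_of_mem (rels := relators N) (Or.inl ⟨i, j, h, rfl⟩)
  rw [map_mul, map_inv, mul_inv_eq_one, map_mul, map_mul] at this
  exact this

theorem σ_braid {i j : Fin (N - 1)} (h : i.val + 1 = j.val) :
    (σ i * σ j * σ i : BraidGroup N) = σ j * σ i * σ j := by
  have : PresentedGroup.mk (relators N) _ = 1 :=
    PresentedGroup.one_of_mem (rels := relators N) (Or.inr ⟨i, j, h, rfl⟩)
  rw [map_mul, map_inv, mul_inv_eq_one, map_mul, map_mul, map_mul, map_mul] at this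
  exact this

theorem adjSwap_comm {i j : Fin (N - 1)} (h : i.val + 2 ≤ j.val) :
    adjSwap i * adjSwap j = adjSwap j * adjSwap i := by
  have e : adjSwap i * adjSwap j = Equiv.swap (adjSwap i (lo j)) (adjSwap i (hi j)) * adjSwap i :=
    Equiv.mul_swap_eq_swap_mul _ _ _
  rw [e, adjSwap_of_ne, adjSwap_of_ne, ← adjSwap]
  all_goals simp [lo, hi, Fin.ext_iff]; omega

theorem adjSwap_braid {i j : Fin (N - 1)} (h : i.val + 1 = j.val) :
    adjSwap i * (adjSwap j * adjSwap i) = adjSwap j * (adjSwap i * adjSwap j) := by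
  have hlh : lo j = hi i := by simp [lo, hi, Fin.ext_iff]; omega
  have n1 : hi j ≠ lo i := by simp [lo, hi, Fin.ext_iff]; omega
  have n2 : hi j ≠ hi i := by simp [hi, Fin.ext_iff]; omega
  have n3 : lo i ≠ hi i := (lo_lt_hi i).ne
  have e1 : adjSwap j * adjSwap i =
      Equiv.swap (adjSwap j (lo i)) (adjSwap j (hi i)) * adjSwap j :=
    Equiv.mul_swap_eq_swap_mul _ _ _
  have e2 : adjSwap j (lo i) = lo i := adjSwap_of_ne (by rw [hlh]; exact n3) n1.symm
  have e3 : adjSwap j (hi i) = hi j := by rw [← hlh, adjSwap_lo]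
  rw [e1, e2, e3, ← mul_assoc, Equiv.mul_swap_eq_swap_mul, adjSwap_lo, adjSwap_of_ne n1 n2,
    ← hlh, mul_assoc]
  rfl

theorem len_of_cons_reduced {n : ℕ} {i : Fin (N - 1)} {u : List (Fin (N - 1))}
    {p : Equiv.Perm (Fin N)} (hu : u.length = n) (hp : wordPerm (i :: u) = p)
    (hl : len p = n + 1) :
    wordPerm u = adjSwap i * p ∧ len (wordPerm u) = n ∧ p⁻¹ (hi i) < p⁻¹ (lo i) := by
  rw [wordPerm_cons] at hp
  have h1 : wordPerm u = adjSwap i * p := by rw [← hp, adjSwap_mul_cancel]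
  have h2 := len_wordPerm_le u
  have h3 : p⁻¹ (hi i) < p⁻¹ (lo i) := by
    refine (inv_lt_or_gt p⁻¹ i).resolve_left fun h => ?_
    have := len_adjSwap_mul h
    rw [h1] at h2
    omega
  have := len_adjSwap_mul_of_descent h3
  exact ⟨h1, by rw [h1]; omega, h3⟩

/-- Matsumoto's theorem for the symmetric group: all reduced words of a permutation spell the
same positive braid. -/
theorem wordBraid_eq_of_reduced (n : ℕ) : ∀ (p : Equiv.Perm (Fin N)) (w w' : List (Fin (N - 1))),
    w.length = n → w'.length = n → wordPerm w = p → wordPerm w' = p → len p = n →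
    wordBraid w = wordBraid w' := by
  induction n using Nat.strong_induction_on with
  | _ n ih =>
  rcases n with _ | n
  · intro p w w' hw hw' _ _ _
    rw [List.length_eq_zero_iff.1 hw, List.length_eq_zero_iff.1 hw']
  -- Two distinct first letters are both descents, so `p` has reduced words starting with either
  -- side of the relation between them. Induction compares the tails with `u` and `v`.
  have main : ∀ (p : Equiv.Perm (Fin N)) (i j : Fin (N - 1)) (u v : List (Fin (N - 1))),
      i < j → u.length = n → v.length = n → wordPerm (i :: u) = p → wordPerm (j :: v) = p →
      len p = n + 1 → wordBraid (i :: u) = wordBraid (j :: v) := by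
    intro p i j u v hij hu hv hpu hpv hl
    obtain ⟨eu, lu, du⟩ := len_of_cons_reduced hu hpu hl
    obtain ⟨ev, lv, dv⟩ := len_of_cons_reduced hv hpv hl
    rw [wordBraid_cons, wordBraid_cons]
    have hij' : i.val < j.val := hij
    by_cases hfar : i.val + 2 ≤ j.val
    · have d2 : (adjSwap j * p)⁻¹ (hi i) < (adjSwap j * p)⁻¹ (lo i) := by
        rw [adjSwap_mul_inv_apply, adjSwap_mul_inv_apply, adjSwap_of_ne, adjSwap_of_ne]
        · exact du
        all_goals simp [lo, hi, Fin.ext_iff]; omega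
      have l2 := len_adjSwap_mul_of_descent d2
      rw [← ev, lv] at l2
      obtain ⟨t, ht, htl⟩ := exists_wordPerm_eq (n - 1) (adjSwap i * wordPerm v) (by omega)
      have pu : wordPerm (j :: t) = adjSwap i * p := by
        rw [wordPerm_cons, ht, ev, ← mul_assoc, ← adjSwap_comm hfar, mul_assoc,
          adjSwap_mul_cancel]
      have pv : wordPerm (i :: t) = adjSwap j * p := by
        rw [wordPerm_cons, ht, ev, adjSwap_mul_cancel]
      rw [ih n (by omega) _ u (j :: t) hu (by simp; omega) eu pu (by rw [← eu, lu]),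
        ih n (by omega) _ v (i :: t) hv (by simp; omega) ev pv (by rw [← ev, lv]),
        wordBraid_cons, wordBraid_cons, ← mul_assoc, ← mul_assoc, σ_comm hfar]
    · have hadj : i.val + 1 = j.val := by omega
      have hlh : lo j = hi i := by simp [lo, hi, Fin.ext_iff]; omega
      have n1 : hi j ≠ lo i := by simp [lo, hi, Fin.ext_iff]; omega
      have n2 : hi j ≠ hi i := by simp [hi, Fin.ext_iff]; omega
      have n3 : lo i ≠ hi i := (lo_lt_hi i).ne
      rw [hlh] at dv
      have s1 : adjSwap j (hi i) = hi j := by rw [← hlh, adjSwap_lo]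
      have s2 : adjSwap j (hi j) = hi i := by rw [adjSwap_hi, hlh]
      have s3 : adjSwap j (lo i) = lo i := adjSwap_of_ne (by rw [hlh]; exact n3) n1.symm
      -- By `du` and `dv`, `p⁻¹` reverses three consecutive symbols, so three letters can be peeled
      -- off.
      have d2 : (adjSwap j * p)⁻¹ (hi i) < (adjSwap j * p)⁻¹ (lo i) := by
        rw [adjSwap_mul_inv_apply, adjSwap_mul_inv_apply, s1, s3]
        exact dv.trans du
      have d3 : (adjSwap i * (adjSwap j * p))⁻¹ (hi j) <
          (adjSwap i * (adjSwap j * p))⁻¹ (lo j) := by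
        rw [adjSwap_mul_inv_apply, adjSwap_mul_inv_apply, adjSwap_mul_inv_apply,
          adjSwap_mul_inv_apply, hlh, adjSwap_hi, adjSwap_of_ne n1 n2, s2, s3]
        exact du
      have l2 := len_adjSwap_mul_of_descent d2
      have l3 := len_adjSwap_mul_of_descent d3
      rw [← ev] at l2 l3
      rw [lv] at l2
      obtain ⟨t, ht, htl⟩ :=
        exists_wordPerm_eq (n - 2) (adjSwap j * (adjSwap i * wordPerm v)) (by omega)
      have pv : wordPerm (i :: j :: t) = adjSwap j * p := by
        rw [wordPerm_cons, wordPerm_cons, ht, ev, adjSwap_mul_cancel, adjSwap_mul_cancel]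
      have pu : wordPerm (j :: i :: t) = adjSwap i * p := by
        have hb := congrArg (· * p) (adjSwap_braid hadj)
        simp only [mul_assoc] at hb
        rw [wordPerm_cons, wordPerm_cons, ht, ev, ← hb, adjSwap_mul_cancel, adjSwap_mul_cancel]
      rw [ih n (by omega) _ u (j :: i :: t) hu (by simp; omega) eu pu (by rw [← eu, lu]),
        ih n (by omega) _ v (i :: j :: t) hv (by simp; omega) ev pv (by rw [← ev, lv]),
        wordBraid_cons, wordBraid_cons, wordBraid_cons, wordBraid_cons]
      simp only [← mul_assoc]
      rw [σ_braid hadj]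
  intro p w w' hw hw' hp hp' hl
  match w, w' with
  | i :: u, j :: v =>
    simp only [List.length_cons, Nat.add_right_cancel_iff] at hw hw'
    rcases lt_trichotomy i j with h | h | h
    · exact main p i j u v h hw hw' hp hp' hl
    · subst h
      obtain ⟨eu, lu, -⟩ := len_of_cons_reduced hw hp hl
      obtain ⟨ev, -, -⟩ := len_of_cons_reduced hw' hp' hl
      rw [wordBraid_cons, wordBraid_cons, ih n (by omega) _ u v hw hw' eu ev (by rw [← eu, lu])]
    · exact (main p j i v u h hw' hw hp' hp hl).symm

/-! ### Permutation braids and the half twist -/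

theorem permBraid_eq_wordBraid {p : Equiv.Perm (Fin N)} {w : List (Fin (N - 1))}
    (hw : wordPerm w = p) (hl : w.length = len p) : permBraid p = wordBraid w := by
  obtain ⟨h1, h2⟩ := (exists_isReducedWord p).choose_spec
  refine wordBraid_eq_of_reduced _ p _ w (le_antisymm (hl ▸ h2 w hw) ?_) hl h1 hw rfl
  conv_lhs => rw [← h1]
  exact len_wordPerm_le _

theorem exists_permBraid_eq (p : Equiv.Perm (Fin N)) : ∃ w : List (Fin (N - 1)),
    wordPerm w = p ∧ w.length = len p ∧ permBraid p = wordBraid w := by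
  obtain ⟨w, hw, hl⟩ := exists_wordPerm_eq _ p rfl
  exact ⟨w, hw, hl, permBraid_eq_wordBraid hw hl⟩

theorem permBraid_one : permBraid (1 : Equiv.Perm (Fin N)) = 1 :=
  permBraid_eq_wordBraid (w := []) rfl len_one.symm

theorem permBraid_adjSwap_mul {i : Fin (N - 1)} {p : Equiv.Perm (Fin N)}
    (h : p⁻¹ (lo i) < p⁻¹ (hi i)) : permBraid (adjSwap i * p) = σ i * permBraid p := by
  obtain ⟨w, hw, hl, hb⟩ := exists_permBraid_eq p
  rw [hb, ← wordBraid_cons]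
  exact permBraid_eq_wordBraid (by rw [wordPerm_cons, hw])
    (by rw [len_adjSwap_mul h, List.length_cons, hl])

theorem permBraid_mul_adjSwap {i : Fin (N - 1)} {p : Equiv.Perm (Fin N)}
    (h : p (lo i) < p (hi i)) : permBraid (p * adjSwap i) = permBraid p * σ i := by
  obtain ⟨w, hw, hl, hb⟩ := exists_permBraid_eq p
  have : permBraid p * σ i = wordBraid (w ++ [i]) := by simp [hb, wordBraid]
  rw [this]
  exact permBraid_eq_wordBraid (by rw [← hw]; simp [wordPerm])
    (by rw [len_mul_adjSwap h, List.length_append, hl]; rfl)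

/-- A generator with which `q` starts can be moved to the end of `p`. -/
theorem permBraid_mul_permBraid_slide {i : Fin (N - 1)} {p q : Equiv.Perm (Fin N)}
    (hq : q⁻¹ (hi i) < q⁻¹ (lo i)) (hp : p (lo i) < p (hi i)) :
    permBraid (p * adjSwap i) * permBraid (adjSwap i * q) = permBraid p * permBraid q := by
  have h := permBraid_adjSwap_mul (i := i) (p := adjSwap i * q) (by
    rwa [adjSwap_mul_inv_apply, adjSwap_mul_inv_apply, adjSwap_lo, adjSwap_hi])
  rw [adjSwap_mul_cancel] at h
  rw [h, permBraid_mul_adjSwap hp, mul_assoc]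

theorem len_le (p : Equiv.Perm (Fin N)) : len p ≤ N * N :=
  (Finset.card_le_univ _).trans (by simp)

/-- The complement can start with `σ i` exactly where `p` ascends at `i`. Sliding that letter over
lengthens `p`, until `p` is the reversal and the complement is trivial. -/
theorem permBraid_mul_complement (n : ℕ) (p : Equiv.Perm (Fin N)) (hn : N * N - len p = n) :
    permBraid p * permBraid (p⁻¹ * Fin.revPerm) = Δ N := by
  induction n using Nat.strong_induction_on generalizing p with
  | _ n ih =>
  by_cases h : ∃ i, p (lo i) < p (hi i)
  · obtain ⟨i, h⟩ := h
    rw [← permBraid_mul_permBraid_slide (i := i) _ h]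
    · have hl := len_mul_adjSwap h
      have hle := len_le (p * adjSwap i)
      rw [← ih _ (by omega) (p * adjSwap i) rfl, mul_inv_rev, adjSwap_inv, mul_assoc]
    · have e : (p⁻¹ * Fin.revPerm)⁻¹ = Fin.revPerm * p := by
        rw [mul_inv_rev, inv_inv]; rfl
      rw [e]
      simpa using h
  · push Not at h
    have hp : p = Fin.revPerm := eq_revPerm_of_forall_lt fun i =>
      (inv_lt_or_gt p i).resolve_left (h i).not_gt
    rw [hp, inv_mul_cancel, permBraid_one, mul_one]
    rfl

/-- Take complements twice: with `q` the complement of `p` and `r` that of `q`, `p * Δ = p * (q * r)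
= Δ * r`. -/
theorem permBraid_mul_Δ (p : Equiv.Perm (Fin N)) :
    permBraid p * Δ N = Δ N * permBraid (Fin.revPerm⁻¹ * p * Fin.revPerm) := by
  have h := permBraid_mul_complement _ (p⁻¹ * Fin.revPerm) rfl
  rw [mul_inv_rev, inv_inv] at h
  conv_lhs => rw [← h]
  rw [← mul_assoc, permBraid_mul_complement _ p rfl, mul_assoc]

theorem permBraid_mul_Δ_inv (p : Equiv.Perm (Fin N)) :
    permBraid p * (Δ N)⁻¹ = (Δ N)⁻¹ * permBraid (Fin.revPerm * p * Fin.revPerm⁻¹) := by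
  rw [mul_inv_eq_iff_eq_mul, mul_assoc, permBraid_mul_Δ, inv_mul_cancel_left]
  congr 1
  group

theorem exists_permBraid_mul_Δ_zpow (j : ℤ) (p : Equiv.Perm (Fin N)) :
    ∃ q, permBraid p * Δ N ^ j = Δ N ^ j * permBraid q := by
  induction j with
  | zero => exact ⟨p, by simp⟩
  | succ n ih =>
    obtain ⟨q, hq⟩ := ih
    exact ⟨_, by rw [zpow_add_one, ← mul_assoc, hq, mul_assoc, permBraid_mul_Δ, ← mul_assoc]⟩
  | pred n ih =>
    obtain ⟨q, hq⟩ := ih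
    exact ⟨_, by
      rw [zpow_sub_one, ← mul_assoc, hq, mul_assoc, permBraid_mul_Δ_inv, ← mul_assoc]⟩

theorem exists_prod_mul_Δ_zpow (j : ℤ) (l : List (Equiv.Perm (Fin N))) :
    ∃ l' : List (Equiv.Perm (Fin N)), l'.length = l.length ∧
      (l.map permBraid).prod * Δ N ^ j = Δ N ^ j * (l'.map permBraid).prod := by
  induction l with
  | nil => exact ⟨[], rfl, by simp⟩
  | cons p l ih =>
    obtain ⟨l', hl, h⟩ := ih
    obtain ⟨q, hq⟩ := exists_permBraid_mul_Δ_zpow j p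
    refine ⟨q :: l', by simp [hl], ?_⟩
    rw [List.map_cons, List.prod_cons, List.map_cons, List.prod_cons, mul_assoc, h, ← mul_assoc,
      hq, mul_assoc]

/-! ### Boxes and their arithmetic -/

/-- The braids that are `Δ ^ i` times a product of `s - i` permutation braids. -/
def box (N : ℕ) (i s : ℤ) : Set (BraidGroup N) :=
  {x | ∃ l : List (Equiv.Perm (Fin N)),
    x = Δ N ^ i * (l.map permBraid).prod ∧ i + (l.length : ℤ) = s}

theorem mul_mem_box {x y : BraidGroup N} {i s j t : ℤ} (hx : x ∈ box N i s) (hy : y ∈ box N j t) :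
    x * y ∈ box N (i + j) (s + t) := by
  obtain ⟨l, rfl, rfl⟩ := hx
  obtain ⟨l', rfl, rfl⟩ := hy
  obtain ⟨l₁, h₁, h⟩ := exists_prod_mul_Δ_zpow j l
  refine ⟨l₁ ++ l', ?_, ?_⟩
  · rw [List.map_append, List.prod_append, zpow_add, mul_assoc, ← mul_assoc _ (Δ N ^ j), h]
    simp only [mul_assoc]
  · rw [List.length_append, h₁]
    push_cast
    ring

/-- This is the padding that lets boxes be enlarged, although the number of factors is exact. -/
theorem one_mem_box (a b : ℕ) : (1 : BraidGroup N) ∈ box N (-a) b := by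
  refine ⟨List.replicate a Fin.revPerm ++ List.replicate b 1, ?_, ?_⟩
  · simp [permBraid_one, Δ]
  · simp

theorem box_mono {i s i' s' : ℤ} (hi : i' ≤ i) (hs : s ≤ s') : box N i s ⊆ box N i' s' := by
  intro x hx
  have h := mul_mem_box hx (one_mem_box (i - i').toNat (s' - s).toNat)
  rwa [mul_one, show i + -((i - i').toNat : ℤ) = i' by omega,
    show s + ((s' - s).toNat : ℤ) = s' by omega] at h

theorem inv_permBraid_mem_box (p : Equiv.Perm (Fin N)) : (permBraid p)⁻¹ ∈ box N (-1) 0 := by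
  have h := permBraid_mul_complement _ p rfl
  refine ⟨[Fin.revPerm * (p⁻¹ * Fin.revPerm) * Fin.revPerm⁻¹], ?_, by simp⟩
  rw [List.map_singleton, List.prod_singleton, zpow_neg_one, ← permBraid_mul_Δ_inv, ← h]
  group

theorem inv_mem_box {x : BraidGroup N} {i s : ℤ} (hx : x ∈ box N i s) :
    x⁻¹ ∈ box N (-s) (-i) := by
  obtain ⟨l, rfl, rfl⟩ := hx
  have key : ((l.map permBraid).prod)⁻¹ ∈ box N (-l.length) 0 := by
    induction l with
    | nil => simpa using one_mem_box (N := N) 0 0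
    | cons p l ih =>
      rw [List.map_cons, List.prod_cons, mul_inv_rev]
      have h := mul_mem_box ih (inv_permBraid_mem_box p)
      rwa [show -(l.length : ℤ) + -1 = -((p :: l).length : ℤ) by simp; ring, add_zero] at h
  have hΔ : (Δ N ^ i)⁻¹ ∈ box N (-i) (-i) := ⟨[], by simp, by simp⟩
  have h := mul_mem_box key hΔ
  rwa [← mul_inv_rev, zero_add, ← neg_add, add_comm] at h

/-! ### From boxes to left normal forms -/

/-- The sum of the lengths of the factors, the earlier ones weighted more. -/
def weight : List (Equiv.Perm (Fin N)) → ℕ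
  | [] => 0
  | p :: l => (l.length + 1) * len p + weight l

/-- At a pair that is not left weighted, a slide moves one crossing to a factor whose coefficient is
larger by one, which raises the weight. -/
theorem isChain_of_weight_maximal (l : List (Equiv.Perm (Fin N)))
    (h : ∀ l' : List (Equiv.Perm (Fin N)), l'.length = l.length →
      (l'.map permBraid).prod = (l.map permBraid).prod → weight l' ≤ weight l) :
    l.IsChain LeftWeighted := by
  induction l with
  | nil => exact List.IsChain.nil
  | cons p l ih =>
    have hl : l.IsChain LeftWeighted := ih fun l' h1 h2 => by
      have := h (p :: l') (by simp [h1]) (by simp [h2])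
      simpa [weight, h1] using this
    rcases l with _ | ⟨q, l⟩
    · exact List.isChain_singleton p
    · refine List.isChain_cons_cons.2 ⟨fun i hi => ?_, hl⟩
      refine (inv_lt_or_gt p i).resolve_left fun hp => ?_
      have hw := h (p * adjSwap i :: adjSwap i * q :: l) (by simp) (by
        simp only [List.map_cons, List.prod_cons]
        rw [← mul_assoc, permBraid_mul_permBraid_slide hi hp, mul_assoc])
      simp only [weight, len_mul_adjSwap hp, ← len_adjSwap_mul_of_descent hi,
        List.length_cons] at hw
      nlinarith

theorem exists_isChain_leftWeighted (l : List (Equiv.Perm (Fin N))) :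
    ∃ l' : List (Equiv.Perm (Fin N)), l'.length = l.length ∧
      (l'.map permBraid).prod = (l.map permBraid).prod ∧ l'.IsChain LeftWeighted := by
  let S : Set (List (Equiv.Perm (Fin N))) :=
    {l' | l'.length = l.length ∧ (l'.map permBraid).prod = (l.map permBraid).prod}
  have hS : S.Finite := (List.finite_length_eq _ l.length).subset fun _ h => h.1
  obtain ⟨l', hl', hmax⟩ := Set.exists_max_image S weight hS ⟨l, rfl, rfl⟩
  exact ⟨l', hl'.1, hl'.2, isChain_of_weight_maximal l' fun l₁ h1 h2 =>
    hmax l₁ ⟨h1.trans hl'.1, h2.trans hl'.2⟩⟩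

/-- The trivial braid ends with no generator, so trivial factors can occur only at the end of a left
weighted sequence. -/
theorem LeftWeighted.eq_one {q : Equiv.Perm (Fin N)} (h : LeftWeighted 1 q) : q = 1 := by
  have : q⁻¹ = 1 := eq_one_of_forall_lt fun i =>
    (inv_lt_or_gt q⁻¹ i).resolve_right fun hi => lt_asymm (h i hi) (lo_lt_hi i)
  exact inv_eq_one.1 this

/-- Trivial factors can be dropped from a left weighted sequence. -/
theorem exists_isChain_ne_one (l : List (Equiv.Perm (Fin N))) (hl : l.IsChain LeftWeighted) :
    ∃ l' : List (Equiv.Perm (Fin N)), l'.length ≤ l.length ∧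
      (l'.map permBraid).prod = (l.map permBraid).prod ∧ l'.IsChain LeftWeighted ∧
      (∀ q ∈ l', q ≠ 1) ∧ (l' = [] ∨ l'.head? = l.head?) := by
  induction l with
  | nil => exact ⟨[], by simp⟩
  | cons p l ih =>
    obtain ⟨l', h1, h2, h3, h4, h5⟩ := ih hl.tail
    rcases l' with _ | ⟨q, l'⟩
    · by_cases hp : p = 1
      · exact ⟨[], by simp, by simpa [hp, permBraid_one] using h2, by simp, by simp, by simp⟩
      · exact ⟨[p], by simp, by simp [← h2], by simp, by simpa using hp, by simp⟩
    · have h6 : LeftWeighted p q := by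
        rcases l with _ | ⟨q', l⟩
        · simp at h1
        · have : q = q' := by simpa using h5
          exact this ▸ (List.isChain_cons_cons.1 hl).1
      have hp : p ≠ 1 := by
        rintro rfl
        exact h4 q (by simp) h6.eq_one
      refine ⟨p :: q :: l', by simpa using h1, by simp [← h2],
        List.isChain_cons_cons.2 ⟨h6, h3⟩, ?_, by simp⟩
      intro r hr
      rcases List.mem_cons.1 hr with rfl | hr
      exacts [hp, h4 r hr]

/-- Half twists can be split off from the front of a left weighted sequence. -/
theorem exists_isLeftNormalForm (l : List (Equiv.Perm (Fin N))) (hl : l.IsChain LeftWeighted)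
    (h1 : ∀ q ∈ l, q ≠ 1) : ∃ (j : ℕ) (l' : List (Equiv.Perm (Fin N))),
      IsLeftNormalForm (l.map permBraid).prod j l' ∧ j + l'.length = l.length := by
  induction l with
  | nil => exact ⟨0, [], ⟨by simp, by simp, by simp, by simp⟩, rfl⟩
  | cons p l ih =>
    by_cases hp : p = Fin.revPerm
    · obtain ⟨j, l', h, hj⟩ := ih hl.tail fun q hq => h1 q (List.mem_cons_of_mem _ hq)
      refine ⟨j + 1, l', ⟨?_, h.leftWeighted, h.ne_one, h.head_ne⟩, by simp; omega⟩
      rw [List.map_cons, List.prod_cons, h.eq_prod, hp, ← mul_assoc]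
      congr 1
      push_cast
      rw [add_comm, zpow_add, zpow_one]
      rfl
    · exact ⟨0, p :: l, ⟨by simp, hl, h1, by simpa using hp⟩, by simp⟩

theorem box_subset_interval (i s : ℤ) : box N i s ⊆ interval N i s := by
  rintro x ⟨l, rfl, rfl⟩
  obtain ⟨l₁, a1, b1, c1⟩ := exists_isChain_leftWeighted l
  obtain ⟨l₂, a2, b2, c2, d2, -⟩ := exists_isChain_ne_one l₁ c1
  obtain ⟨j, l₃, h, hj⟩ := exists_isLeftNormalForm l₂ c2 d2
  refine ⟨i + j, l₃, ⟨?_, h.leftWeighted, h.ne_one, h.head_ne⟩, ?_, ?_, ?_⟩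
  · rw [← b1, ← b2, h.eq_prod, zpow_add, mul_assoc]
  all_goals omega

/-! ### Short products and the commutator -/

theorem prod_mem_box {n : ℤ} (w : List (BraidGroup N)) (hw : ∀ y ∈ w, y ∈ box N (-n) n) :
    w.prod ∈ box N (-(w.length * n)) (w.length * n) := by
  induction w with
  | nil => simpa using one_mem_box (N := N) 0 0
  | cons y w ih =>
    have h := mul_mem_box (hw y (by simp)) (ih fun z hz => hw z (by simp [hz]))
    rw [List.prod_cons, List.length_cons]
    push_cast
    rwa [← neg_add, ← one_add_mul, add_comm] at h

theorem IsShortProduct.mem_box {k m l : ℕ} {g : Fin k → BraidGroup N} {x : BraidGroup N}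
    (hx : IsShortProduct m g x)
    (hg : ∀ j, ∃ (i : ℤ) (p : List (Equiv.Perm (Fin N))),
      IsLeftNormalForm (g j) i p ∧ (i = 0 ∨ i = 1) ∧ p.length ≤ l) :
    x ∈ box N (-(m * (l + 1))) (m * (l + 1)) := by
  obtain ⟨w, hwm, hw, rfl⟩ := hx
  have hg' : ∀ j, g j ∈ box N (-(l + 1)) (l + 1) := fun j => by
    obtain ⟨i, p, h, hi, hp⟩ := hg j
    exact box_mono (by omega) (by omega) (show g j ∈ box N i (i + p.length) from
      ⟨p, h.eq_prod, rfl⟩)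
  have h := prod_mem_box (n := (l : ℤ) + 1) w fun y hy => by
    obtain ⟨j, rfl | rfl⟩ := hw y hy
    · exact hg' j
    · simpa using inv_mem_box (hg' j)
  have hle : (w.length : ℤ) * (l + 1) ≤ m * (l + 1) :=
    mul_le_mul_of_nonneg_right (by exact_mod_cast hwm) (by positivity)
  exact box_mono (neg_le_neg hle) hle h

end Braid

theorem mainTheorem8 (N : ℕ) (hN : 2 ≤ N) (k l m : ℕ)
    (a b : Fin k → Braid.BraidGroup N)
    (ha : ∀ j, ∃ (i : ℤ) (p : List (Equiv.Perm (Fin N))),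
      Braid.IsLeftNormalForm (a j) i p ∧ (i = 0 ∨ i = 1) ∧ p.length ≤ l)
    (hb : ∀ j, ∃ (i : ℤ) (p : List (Equiv.Perm (Fin N))),
      Braid.IsLeftNormalForm (b j) i p ∧ (i = 0 ∨ i = 1) ∧ p.length ≤ l)
    (x y : Braid.BraidGroup N)
    (hx : Braid.IsShortProduct m a x) (hy : Braid.IsShortProduct m b y) :
    x⁻¹ * y⁻¹ * x * y ∈
      Braid.interval N (-(4 * (m : ℤ) * ((l : ℤ) + 1))) (4 * (m : ℤ) * ((l : ℤ) + 1)) := by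
  have hx' := hx.mem_box ha
  have hy' := hy.mem_box hb
  have h := Braid.mul_mem_box (Braid.mul_mem_box
    (Braid.mul_mem_box (Braid.inv_mem_box hx') (Braid.inv_mem_box hy')) hx') hy'
  refine Braid.box_subset_interval _ _ (Braid.box_mono (le_of_eq ?_) (le_of_eq ?_) h) <;> ring
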